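/- Let $K$ be a field of arbitrary characteristic, $V$ a $K$-vector space of finite dimension $\ell$, and $\Delta=(\alpha_1,\dots,\alpha_n)$ a finite sequence of elements spanning the dual space $V^*$ (zero forms and repetitions are allowed). Let $M(\Delta)$ be the matroid on the ordered set $E=\{1,\dots,n\}$ in which $S\subseteq E$ is independent iff $(\alpha_i)_{i\in S}$ is linearly independent, and let $r$ be its rank function, $L(\Delta)$ its set of flats, and $T(\Delta;x,y)=\sum_{A\subseteq E}(x-1)^{r(E)-r(A)}(y-1)^{|A|-r(A)}$ its Tutte polynomial. For $S\subseteq E$ put $\alpha_S=\prod_{i\in S}\alpha_i\in\operatorname{Sym}(V^*)$. For $X\in L(\Delta)$ let $P(\Delta)_X$ be the $K$-span of those $\alpha_S$ for which $E\setminus S$ has closure $X$ in $M(\Delta)$, and let $P(\Delta)_{X,k}=P(\Delta)_X\cap\operatorname{Sym}^{n-k}(V^*)$ be its part of degree $n-k$. A broken circuit is a circuit of $M(\Delta)$ with its smallest element deleted, and a subset of $E$ is nbc if it contains no broken circuit. Then the sum $\bigoplus_{X\in L(\Delta)}P(\Delta)_{X,r(X)}$ is a direct sum inside $\operatorname{Sym}(V^*)$,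 it is a graded subspace of $\operatorname{Sym}(V^*)$, and its Hilbert series is $$\sum_{d\ge 0}\dim_K\Big(\Big(\bigoplus_{X\in L(\Delta)}P(\Delta)_{X,r(X)}\Big)\cap\operatorname{Sym}^d(V^*)\Big)\,t^d \;=\; t^{\,n-\ell}\,T(\Delta;1+t,0).$$ Moreover, for every flat $X\in L(\Delta)$, the dimension of $P(\Delta)_{X,r(X)}$ equals the number of nbc sets of $M(\Delta)$ with closure $X$. -/

import Mathlib

open Module

/-- The matroid on the index set `ι` of a finite family of vectors `v`: a set of indices is
independent iff the corresponding subfamily is linearly independent. -/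
def vectorMatroid (K : Type*) {W ι : Type*} [Field K] [AddCommGroup W] [Module K W] [Finite ι]
    (v : ι → W) : Matroid ι :=
  (IndepMatroid.ofFinite (E := Set.univ) Set.finite_univ (fun I => LinearIndepOn K v I)
    (linearIndepOn_empty K v)
    (fun _ _ hJ hIJ => hJ.mono hIJ)
    (by
      intro I J hI hJ hlt
      by_contra! hcon
      have hsub : Submodule.span K (v '' J) ≤ Submodule.span K (v '' I) := by
        rw [Submodule.span_le]
        rintro _ ⟨e, he, rfl⟩
        by_cases heI : e ∈ I
        · exact Submodule.subset_span ⟨e, heI, rfl⟩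
        · by_contra hns
          exact hcon e he heI ((linearIndepOn_insert heI).2 ⟨hI, hns⟩)
      have hfin : FiniteDimensional K (Submodule.span K (v '' I)) :=
        FiniteDimensional.span_of_finite K (Set.toFinite _)
      have hle := Submodule.finrank_mono hsub
      have key : ∀ A : Set ι, LinearIndepOn K v A →
          finrank K (Submodule.span K (v '' A)) = A.ncard := by
        intro A hA
        have : Fintype A := Fintype.ofFinite A
        have h := finrank_span_eq_card hA
        rw [← Set.image_eq_range] at h
        rw [h, ← Nat.card_eq_fintype_card, Nat.card_coe_set_eq]
      rw [key I hI, key J hJ] at hle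
      omega)
    (fun _ _ => Set.subset_univ _)).matroid

namespace Matroid

/-- The rank of a set in a matroid, as a natural number (used here for finite matroids only). -/
noncomputable def rankNat {α : Type*} (M : Matroid α) (S : Set α) : ℕ := (M.eRk S).toNat

open scoped Classical in
/-- The Tutte polynomial of a matroid `M` on a finite set `E`, in the two variables `x = X 0` and
`y = X 1`:  `T(M; x, y) = ∑_{A ⊆ E} (x - 1) ^ (r(E) - r(A)) * (y - 1) ^ (|A| - r(A))`. -/
noncomputable def tuttePolynomial {α : Type*} [Fintype α] (M : Matroid α) :
    MvPolynomial (Fin 2) ℤ :=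
  ∑ A ∈ (Finset.univ : Finset (Finset α)).filter (fun A : Finset α => (↑A : Set α) ⊆ M.E),
    (MvPolynomial.X 0 - 1) ^ (M.rankNat M.E - M.rankNat A) *
      (MvPolynomial.X 1 - 1) ^ (A.card - M.rankNat A)

/-- A broken circuit: a circuit with its smallest element deleted. -/
def IsBrokenCircuit {α : Type*} [LinearOrder α] (M : Matroid α) (B : Set α) : Prop :=
  ∃ C : Set α, ∃ c : α, M.IsCircuit C ∧ IsLeast C c ∧ B = C \ {c}

/-- An nbc set: a subset of the ground set that contains no broken circuit. -/
def IsNBC {α : Type*} [LinearOrder α] (M : Matroid α) (S : Set α) : Prop :=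
  S ⊆ M.E ∧ ∀ B : Set α, M.IsBrokenCircuit B → ¬ B ⊆ S

end Matroid

namespace SymmetricAlgebra

/-- `Sym^d(W)`: the degree `d` homogeneous part of the symmetric algebra, spanned by the `d`-fold
products of elements of `W`. -/
noncomputable def homogeneousPart (K W : Type*) [Field K] [AddCommGroup W] [Module K W] (d : ℕ) :
    Submodule K (SymmetricAlgebra K W) :=
  LinearMap.range (SymmetricAlgebra.ι K W) ^ d

/-- A subspace of the symmetric algebra is graded if it is the (automatically direct) sum of its
homogeneous pieces. -/
def IsGradedSubspace {K W : Type*} [Field K] [AddCommGroup W] [Module K W]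
    (P : Submodule K (SymmetricAlgebra K W)) : Prop :=
  P = ⨆ d : ℕ, P ⊓ homogeneousPart K W d

/-- The Hilbert series `∑_d dim (P ∩ Sym^d(W)) t^d` of a graded subspace `P` of `Sym(W)`. -/
noncomputable def hilbertSeries {K W : Type*} [Field K] [AddCommGroup W] [Module K W]
    (P : Submodule K (SymmetricAlgebra K W)) : PowerSeries ℤ :=
  PowerSeries.mk fun d => (finrank K ↥(P ⊓ homogeneousPart K W d) : ℤ)

end SymmetricAlgebra

section ProductSpaces

variable {K V : Type*} [Field K] [AddCommGroup V] [Module K V] {n : ℕ}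

/-- The product `α_S = ∏_{i ∈ S} α_i` in `Sym(V*)`. -/
noncomputable def formProduct (Δ : Fin n → Dual K V) (S : Finset (Fin n)) :
    SymmetricAlgebra K (Dual K V) :=
  ∏ i ∈ S, SymmetricAlgebra.ι K (Dual K V) (Δ i)

/-- `P(Δ)_X`: the span of those `α_S` for which the complement `E - S` has closure `X`. -/
noncomputable def flatSpace (Δ : Fin n → Dual K V) (X : Set (Fin n)) :
    Submodule K (SymmetricAlgebra K (Dual K V)) :=
  Submodule.span K {p | ∃ S : Finset (Fin n),
    (vectorMatroid K Δ).closure ((S : Set (Fin n))ᶜ) = X ∧ p = formProduct Δ S}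

/-- `P(Δ)_{X,k}`: the degree `n - k` part of `P(Δ)_X`, for `k ≤ n`. -/
noncomputable def flatSpaceDeg (Δ : Fin n → Dual K V) (X : Set (Fin n)) (k : ℕ) :
    Submodule K (SymmetricAlgebra K (Dual K V)) :=
  flatSpace Δ X ⊓ SymmetricAlgebra.homogeneousPart K (Dual K V) (n - k)

/-- `P(Δ)_{X,r(X)}`, where `r(X)` is the rank of `X`. -/
noncomputable def flatSpaceTop (Δ : Fin n → Dual K V) (X : Set (Fin n)) :
    Submodule K (SymmetricAlgebra K (Dual K V)) :=
  flatSpaceDeg Δ X ((vectorMatroid K Δ).rankNat X)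

end ProductSpaces

/-! Everything rests on one basis: the products α_{E∖B} with B nbc are linearly independent, and
those with B of closure X span P(Δ)_{X,r(X)}. For spanning, degree n - r(X) leaves only products
α_{E∖B} with B a basis of X, and exchanging elements of B for smaller ones rewrites these through
nbc bases of X (`formProduct_compl_mem_span_nbc`). Independence is a deletion-contraction induction
on the largest index (`eq_zero_of_sum_smul_prod_sdiff_eq_zero`). Sorting the nbc sets by closure
then gives directness and the dimensions. As α_{E∖B} has degree n - |B|, the Hilbert series is the
sum of t^(n-|B|) over nbc sets B, which Whitney's theorem (`sum_neg_one_pow_nullity_mul_rankNat`)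
identifies with t^(n-ℓ) T(1+t, 0). -/

/-! ### Nbc sets and Whitney's broken circuit theorem -/

namespace Matroid

variable {α : Type*} [LinearOrder α] {M : Matroid α}

/-- A circuit through e inside {e} ∪ {i ∈ S | e < i} has e as its least element, so deleting e
leaves a broken circuit in S. -/
theorem isNBC_iff_notMem_closure {S : Set α} :
    M.IsNBC S ↔ S ⊆ M.E ∧ ∀ e, e ∉ M.closure {i ∈ S | e < i} := by
  refine and_congr_right fun hS => ⟨fun h e he => ?_, ?_⟩
  · obtain ⟨C, hCS, hC, heC⟩ := exists_isCircuit_of_mem_closure he (by simp)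
    refine h (C \ {e}) ⟨C, e, hC, ⟨heC, fun x hx => ?_⟩, rfl⟩ fun x hx => ?_
    · rcases hCS hx with rfl | hx
      exacts [le_rfl, hx.2.le]
    · exact ((hCS hx.1).resolve_left hx.2).1
  · rintro h _ ⟨C, c, hC, hc, rfl⟩ hCS
    refine h c (M.closure_subset_closure ?_ (hC.mem_closure_sdiff_singleton_of_mem hc.1))
    exact fun x hx => ⟨hCS hx, lt_of_le_of_ne (hc.2 hx.1) (Ne.symm hx.2)⟩

theorem IsNBC.indep [Finite α] {S : Set α} (h : M.IsNBC S) : M.Indep S := by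
  rw [indep_iff_forall_subset_not_isCircuit h.1]
  intro C hCS hC
  obtain ⟨c, hc, hmin⟩ := C.toFinite.exists_minimal hC.nonempty
  refine h.2 (C \ {c}) ⟨C, c, hC, ⟨hc, fun x hx => ?_⟩, rfl⟩ (Set.sdiff_subset.trans hCS)
  exact (le_total c x).elim id (hmin hx)

theorem rankNat_le_card {α : Type*} (M : Matroid α) (A : Finset α) : M.rankNat A ≤ A.card := by
  have := M.eRk_le_encard A
  rw [Set.encard_coe_eq_coe_finsetCard] at this
  exact ENat.toNat_le_of_le_natCast this

theorem rankNat_mono {α : Type*} [Finite α] (M : Matroid α) {A B : Set α} (h : A ⊆ B) :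
    M.rankNat A ≤ M.rankNat B :=
  ENat.toNat_le_toNat (M.eRk_mono h)
    ((M.eRk_le_encard B).trans_lt B.toFinite.encard_lt_top).ne

theorem Indep.rankNat_eq_ncard {α : Type*} {M : Matroid α} {I : Set α} (hI : M.Indep I) :
    M.rankNat I = I.ncard := by
  rw [rankNat, hI.eRk_eq_encard, Set.ncard]

theorem rankNat_insert_of_mem_closure {α : Type*} {M : Matroid α} {S : Set α} {e : α}
    (he : e ∈ M.closure S) : M.rankNat (insert e S) = M.rankNat S := by
  rw [rankNat, ← eRk_closure_eq, closure_insert_eq_of_mem_closure he, eRk_closure_eq, rankNat]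

theorem rankNat_closure {α : Type*} (M : Matroid α) (S : Set α) :
    M.rankNat (M.closure S) = M.rankNat S := by
  rw [rankNat, eRk_closure_eq, rankNat]

open scoped Classical in
/-- Whitney's broken circuit theorem: in a sum over all subsets weighted by the sign of their
nullity, the subsets that contain a broken circuit cancel. -/
theorem sum_neg_one_pow_nullity_mul_rankNat [Fintype α] {R : Type*} [CommRing R]
    (hE : M.E = Set.univ) (g : ℕ → R) :
    ∑ A : Finset α, (-1) ^ (A.card - M.rankNat A) * g (M.rankNat A) =
      ∑ A ∈ Finset.univ.filter (fun A : Finset α => M.IsNBC (A : Set α)), g A.card := by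
  rw [← Finset.sum_filter_add_sum_filter_not _ (fun A : Finset α => M.IsNBC (A : Set α))]
  have hnbc : ∀ A ∈ (Finset.univ : Finset (Finset α)).filter (fun A : Finset α => M.IsNBC (A : Set α)),
      (-1) ^ (A.card - M.rankNat A) * g (M.rankNat A) = g A.card := by
    intro A hA
    rw [Finset.mem_filter] at hA
    rw [hA.2.indep.rankNat_eq_ncard, Set.ncard_coe_finset]
    simp
  rw [Finset.sum_congr rfl hnbc, add_eq_left]
  -- The cancelling involution toggles the largest e spanned by the elements of A above e.
  have hex : ∀ A ∈ (Finset.univ : Finset (Finset α)).filter (fun A : Finset α => ¬ M.IsNBC (A : Set α)),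
      ∃ e, e ∈ M.closure {i ∈ (A : Set α) | e < i} ∧
        ∀ f, f ∈ M.closure {i ∈ (A : Set α) | f < i} → f ≤ e := by
    intro A hA
    rw [Finset.mem_filter, isNBC_iff_notMem_closure] at hA
    have hne : {e | e ∈ M.closure {i ∈ (A : Set α) | e < i}}.Nonempty := by
      by_contra hcon
      exact hA.2 ⟨by simp [hE], fun e he => hcon ⟨e, he⟩⟩
    obtain ⟨e, he, hmax⟩ := (Set.toFinite _).exists_maximal hne
    exact ⟨e, he, fun f hf => (le_total f e).elim id (hmax hf)⟩
  rcases isEmpty_or_nonempty α with hα | hα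
  · exact Finset.sum_eq_zero fun A hA => isEmptyElim (hex A hA).choose
  choose! e he hmax using hex
  let t : Finset α → α → Finset α := fun A x => if x ∈ A then A.erase x else insert x A
  have hmem : ∀ A x i, i ≠ x → (i ∈ t A x ↔ i ∈ A) := by
    intro A x i hi
    by_cases hx : x ∈ A <;> simp [t, hx, hi]
  have hgt : ∀ A x f, x ≤ f →
      {i ∈ (t A x : Set α) | f < i} = {i ∈ (A : Set α) | f < i} := by
    intro A x f hf
    ext i
    simp only [Finset.mem_coe, Set.mem_ofPred_eq]
    exact and_congr_left fun hi => hmem A x i (hf.trans_lt hi).ne'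
  have htt : ∀ A x, t (t A x) x = A := by
    intro A x
    by_cases hx : x ∈ A <;> simp [t, hx]
  have hnot : ∀ A ∈ (Finset.univ : Finset (Finset α)).filter (fun A : Finset α => ¬ M.IsNBC (A : Set α)),
      t A (e A) ∈ (Finset.univ : Finset (Finset α)).filter (fun A : Finset α => ¬ M.IsNBC (A : Set α)) := by
    intro A hA
    rw [Finset.mem_filter, isNBC_iff_notMem_closure]
    refine ⟨Finset.mem_univ _, fun h => h.2 (e A) ?_⟩
    rw [hgt _ _ _ le_rfl]
    exact he A hA
  -- By `hgt`, toggling e changes no witness f ≥ e, so e stays the largest one.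
  have hinv : ∀ A ∈ (Finset.univ : Finset (Finset α)).filter (fun A : Finset α => ¬ M.IsNBC (A : Set α)),
      e (t A (e A)) = e A := by
    intro A hA
    have h1 : e A ≤ e (t A (e A)) := by
      refine hmax _ (hnot A hA) _ ?_
      rw [hgt _ _ _ le_rfl]
      exact he A hA
    refine le_antisymm (hmax A hA _ ?_) h1
    rw [← hgt A (e A) _ h1]
    exact he _ (hnot A hA)
  -- Adding a spanned element keeps the rank and raises the nullity by one, so the sign flips.
  have hcancel : ∀ (B : Finset α) (x : α), x ∉ B → x ∈ M.closure (B : Set α) →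
      (-1) ^ (B.card - M.rankNat B) * g (M.rankNat B) +
        (-1) ^ ((insert x B).card - M.rankNat (insert x B : Finset α)) *
          g (M.rankNat (insert x B : Finset α)) = 0 := by
    intro B x hx hcl
    rw [Finset.coe_insert, rankNat_insert_of_mem_closure hcl, Finset.card_insert_of_notMem hx,
      Nat.sub_add_comm (M.rankNat_le_card B), pow_succ]
    ring
  refine Finset.sum_involution (fun A _ => t A (e A)) ?_ ?_ hnot ?_
  · intro A hA
    by_cases hx : e A ∈ A
    · have hsub : {i ∈ (A : Set α) | e A < i} ⊆ (A.erase (e A) : Finset α) := by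
        intro i hi
        simpa using ⟨hi.1, hi.2.ne'⟩
      have := hcancel (A.erase (e A)) (e A) (by simp)
        (M.closure_subset_closure hsub (he A hA))
      rw [Finset.insert_erase hx] at this
      simpa only [t, if_pos hx, add_comm] using this
    · have := hcancel A (e A) hx (M.closure_subset_closure (Set.sep_subset _ _) (he A hA))
      simpa only [t, if_neg hx] using this
  · intro A hA _ h
    by_cases hx : e A ∈ A
    · have : e A ∈ t A (e A) := by rw [h]; exact hx
      simp [t, hx] at this
    · have : e A ∉ t A (e A) := by rw [h]; exact hx
      simp [t, hx] at this
  · intro A hA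
    simp only [hinv A hA, htt]

end Matroid

/-! ### Closure and rank as linear span and dimension -/

section VectorMatroid

variable {K W ι : Type*} [Field K] [AddCommGroup W] [Module K W] [Finite ι] {v : ι → W}

@[simp]
theorem vectorMatroid_ground : (vectorMatroid K v).E = Set.univ := rfl

theorem vectorMatroid_indep_iff {I : Set ι} :
    (vectorMatroid K v).Indep I ↔ LinearIndepOn K v I := by
  simp [vectorMatroid, IndepMatroid.ofFinite_indep]

theorem span_image_eq_of_isBasis {I S : Set ι} (h : (vectorMatroid K v).IsBasis I S) :
    Submodule.span K (v '' I) = Submodule.span K (v '' S) := by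
  refine le_antisymm (Submodule.span_mono (Set.image_mono h.subset)) ?_
  rw [Submodule.span_le]
  rintro _ ⟨e, he, rfl⟩
  by_cases heI : e ∈ I
  · exact Submodule.subset_span ⟨e, heI, rfl⟩
  · by_contra hns
    refine heI (h.mem_of_insert_indep he ?_)
    exact vectorMatroid_indep_iff.2
      ((linearIndepOn_insert heI).2 ⟨vectorMatroid_indep_iff.1 h.indep, hns⟩)

theorem mem_closure_vectorMatroid {S : Set ι} {e : ι} :
    e ∈ (vectorMatroid K v).closure S ↔ v e ∈ Submodule.span K (v '' S) := by
  obtain ⟨I, hI⟩ := (vectorMatroid K v).exists_isBasis S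
  rw [← hI.closure_eq_closure, ← span_image_eq_of_isBasis hI]
  by_cases heI : e ∈ I
  · exact iff_of_true ((vectorMatroid K v).mem_closure_of_mem heI)
      (Submodule.subset_span ⟨e, heI, rfl⟩)
  · rw [hI.indep.mem_closure_iff_of_notMem heI, ← Matroid.not_indep_iff, vectorMatroid_indep_iff,
      linearIndepOn_insert heI, not_and_not_right]
    exact ⟨fun h => h (vectorMatroid_indep_iff.1 hI.indep), fun h _ => h⟩

theorem finrank_span_image_of_linearIndepOn {W ι : Type*} [AddCommGroup W] [Module K W]
    {v : ι → W} {A : Set ι} (hfin : A.Finite) (hA : LinearIndepOn K v A) :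
    finrank K (Submodule.span K (v '' A)) = A.ncard := by
  have := hfin.fintype
  have h := finrank_span_eq_card hA
  rw [← Set.image_eq_range] at h
  rw [h, ← Nat.card_eq_fintype_card, Nat.card_coe_set_eq]

theorem rankNat_vectorMatroid (S : Set ι) :
    (vectorMatroid K v).rankNat S = finrank K (Submodule.span K (v '' S)) := by
  obtain ⟨I, hI⟩ := (vectorMatroid K v).exists_isBasis S
  rw [← span_image_eq_of_isBasis hI, finrank_span_image_of_linearIndepOn I.toFinite
    (vectorMatroid_indep_iff.1 hI.indep), Matroid.rankNat, hI.eRk_eq_encard, Set.ncard]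

theorem isNBC_vectorMatroid_iff [LinearOrder ι] {S : Set ι} :
    (vectorMatroid K v).IsNBC S ↔ ∀ e, v e ∉ Submodule.span K (v '' {i ∈ S | e < i}) := by
  simp [Matroid.isNBC_iff_notMem_closure, mem_closure_vectorMatroid]

end VectorMatroid

/-! ### Homogeneous components in the symmetric algebra -/

namespace SymmetricAlgebra

section Grading

variable (K W : Type*) [Field K] [AddCommGroup W] [Module K W]

/-- The algebra homomorphism `Sym(W) → Sym(W)[X]` that multiplies each generator by `X`, so that
the coefficients of the image of `p` are the homogeneous components of `p`. -/
noncomputable def homogenize : SymmetricAlgebra K W →ₐ[K] Polynomial (SymmetricAlgebra K W) :=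
  SymmetricAlgebra.lift
    (LinearMap.mulLeft K Polynomial.X ∘ₗ Polynomial.CAlgHom.toLinearMap ∘ₗ SymmetricAlgebra.ι K W)

variable {K W}

theorem homogenize_of_mem_homogeneousPart {d : ℕ} {p : SymmetricAlgebra K W}
    (hp : p ∈ homogeneousPart K W d) : homogenize K W p = Polynomial.monomial d p := by
  induction d generalizing p with
  | zero =>
    rw [homogeneousPart, pow_zero, Submodule.mem_one] at hp
    obtain ⟨c, rfl⟩ := hp
    rw [AlgHom.commutes]
    rfl
  | succ d ih =>
    rw [homogeneousPart, pow_succ] at hp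
    induction hp using Submodule.mul_induction_on' with
    | mem_mul_mem a ha b hb =>
      obtain ⟨w, rfl⟩ := hb
      rw [map_mul, ih ha, homogenize, SymmetricAlgebra.lift_ι_apply]
      simp only [← Polynomial.C_mul_X_pow_eq_monomial, LinearMap.comp_apply,
        LinearMap.mulLeft_apply, AlgHom.toLinearMap_apply, Polynomial.CAlgHom_apply, map_mul]
      ring
    | add x _ y _ hx hy => rw [map_add, map_add, hx, hy]

theorem prod_ι_mem_homogeneousPart {ι : Type*} (v : ι → W) (S : Finset ι) :
    ∏ i ∈ S, SymmetricAlgebra.ι K W (v i) ∈ homogeneousPart K W S.card := by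
  classical
  induction S using Finset.induction_on with
  | empty => simp [homogeneousPart]
  | insert a S ha ih =>
    rw [Finset.prod_insert ha, Finset.card_insert_of_notMem ha, homogeneousPart, pow_succ']
    exact Submodule.mul_mem_mul (LinearMap.mem_range_self _ _) ih

variable {β : Type*} {p : β → SymmetricAlgebra K W} {deg : β → ℕ}

theorem span_image_inf_homogeneousPart (hp : ∀ b, p b ∈ homogeneousPart K W (deg b)) (s : Set β)
    (d : ℕ) :
    Submodule.span K (p '' s) ⊓ homogeneousPart K W d =
      Submodule.span K (p '' {b ∈ s | deg b = d}) := by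
  apply le_antisymm
  · rintro x ⟨hx, hxd⟩
    -- Projection to the degree d component: it fixes the generators of degree d and kills the
    -- others.
    let π : SymmetricAlgebra K W →ₗ[K] SymmetricAlgebra K W :=
      (Polynomial.lcoeff (SymmetricAlgebra K W) d).restrictScalars K ∘ₗ
        (homogenize K W).toLinearMap
    have hπ : ∀ e y, y ∈ homogeneousPart K W e → π y = if e = d then y else 0 := by
      intro e y hy
      simp [π, homogenize_of_mem_homogeneousPart hy, Polynomial.coeff_monomial]
    have hle : Submodule.span K (p '' s) ≤
        (Submodule.span K (p '' {b ∈ s | deg b = d})).comap π := by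
      rw [Submodule.span_le]
      rintro _ ⟨b, hb, rfl⟩
      rw [SetLike.mem_coe, Submodule.mem_comap, hπ _ _ (hp b)]
      split_ifs with h
      · exact Submodule.subset_span ⟨b, ⟨hb, h⟩, rfl⟩
      · exact zero_mem _
    have := hle hx
    rwa [Submodule.mem_comap, hπ d x hxd, if_pos rfl] at this
  · rw [Submodule.span_le]
    rintro _ ⟨b, ⟨hb, rfl⟩, rfl⟩
    exact ⟨Submodule.subset_span ⟨b, hb, rfl⟩, hp b⟩

theorem isGradedSubspace_span_image (hp : ∀ b, p b ∈ homogeneousPart K W (deg b)) (s : Set β) :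
    IsGradedSubspace (Submodule.span K (p '' s)) := by
  refine le_antisymm ?_ (iSup_le fun _ => inf_le_left)
  rw [Submodule.span_le]
  rintro _ ⟨b, hb, rfl⟩
  exact Submodule.mem_iSup_of_mem (deg b) ⟨Submodule.subset_span ⟨b, hb, rfl⟩, hp b⟩

end Grading

theorem ι_injective (K W : Type*) [Field K] [AddCommGroup W] [Module K W] :
    Function.Injective (SymmetricAlgebra.ι K W) := by
  let b := Module.Free.chooseBasis K W
  have h : (equivMvPolynomial b).toLinearMap ∘ₗ SymmetricAlgebra.ι K W =
      b.constr K MvPolynomial.X := b.ext fun i => by simp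
  have hinj : Function.Injective (b.constr K (MvPolynomial.X (R := K))) :=
    b.injective_constr_of_linearIndependent (MvPolynomial.linearIndependent_X _ _)
  rw [← h] at hinj
  exact Function.Injective.of_comp (f := (equivMvPolynomial b).toLinearMap) hinj

end SymmetricAlgebra

/-! ### Independence and straightening of the nbc products -/

section NBCProducts

/-- The products of the linear forms outside the nbc sets are linearly independent: a linear
relation `c` supported on nbc subsets of `E` vanishes. -/
theorem eq_zero_of_sum_smul_prod_sdiff_eq_zero {K W α : Type*} [Field K] [AddCommGroup W]
    [Module K W] [LinearOrder α] (v : α → W) (E : Finset α) (c : Finset α → K)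
    (hc : ∀ B ⊆ E, (∃ e ∈ E, v e ∈ Submodule.span K (v '' {i ∈ (B : Set α) | e < i})) → c B = 0)
    (hsum : ∑ B ∈ E.powerset, c B • ∏ i ∈ E \ B, SymmetricAlgebra.ι K W (v i) = 0) :
    ∀ B ⊆ E, c B = 0 := by
  -- `W` must vary, since contracting the largest element a replaces it by W / ⟨v a⟩.
  induction E using Finset.induction_on_max generalizing W c with
  | empty =>
    intro B hB
    rw [Finset.subset_empty.1 hB]
    simpa using hsum
  | insert a s hmax ih =>
    have has : a ∉ s := fun h => (hmax a h).false
    by_cases ha : v a = 0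
    -- A zero form is a loop, and then no set is nbc.
    · exact fun B hB => hc B hB ⟨a, Finset.mem_insert_self _ _, by simp [ha]⟩
    rw [Finset.sum_powerset_insert has] at hsum
    have h1 : ∀ t ∈ s.powerset, c t • ∏ i ∈ insert a s \ t, SymmetricAlgebra.ι K W (v i) =
        SymmetricAlgebra.ι K W (v a) * c t • ∏ i ∈ s \ t, SymmetricAlgebra.ι K W (v i) := by
      intro t ht
      rw [Finset.mem_powerset] at ht
      rw [Finset.insert_sdiff_of_notMem _ (fun h => has (ht h)), Finset.prod_insert (by simp [has]),
        mul_smul_comm]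
    have h2 : ∀ t ∈ s.powerset,
        c (insert a t) • ∏ i ∈ insert a s \ insert a t, SymmetricAlgebra.ι K W (v i) =
          c (insert a t) • ∏ i ∈ s \ t, SymmetricAlgebra.ι K W (v i) := by
      intro t _
      rw [Finset.insert_sdiff_insert, Finset.sdiff_insert_of_notMem has]
    rw [Finset.sum_congr rfl h1, Finset.sum_congr rfl h2, ← Finset.mul_sum] at hsum
    let U : Submodule K W := Submodule.span K {v a}
    let φ : SymmetricAlgebra K W →ₐ[K] SymmetricAlgebra K (W ⧸ U) :=
      SymmetricAlgebra.lift (SymmetricAlgebra.ι K (W ⧸ U) ∘ₗ U.mkQ)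
    have hφ : ∀ w, φ (SymmetricAlgebra.ι K W w) = SymmetricAlgebra.ι K (W ⧸ U) (U.mkQ w) :=
      fun w => SymmetricAlgebra.lift_ι_apply _ _
    -- Modulo v a only the terms with a ∈ B survive. Since a exceeds every e ∈ s, a violation for t
    -- in the quotient lifts to one for `insert a t`.
    have hcontract : ∀ t ⊆ s, c (insert a t) = 0 := by
      refine ih (U.mkQ ∘ v) (fun t => c (insert a t)) ?_ ?_
      · rintro t ht ⟨e, he, hspan⟩
        refine hc _ (Finset.insert_subset_insert _ ht) ⟨e, Finset.mem_insert_of_mem he, ?_⟩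
        rw [Set.image_comp, ← Submodule.map_span, Function.comp_apply, ← Submodule.mem_comap,
          Submodule.comap_map_mkQ, ← Submodule.span_union, Set.singleton_union,
          ← Set.image_insert_eq] at hspan
        refine Submodule.span_mono (Set.image_mono ?_) hspan
        rintro i (rfl | hi)
        · exact ⟨by simp, hmax e he⟩
        · exact ⟨by simp [Finset.mem_coe.1 hi.1], hi.2⟩
      · have hva : U.mkQ (v a) = 0 := by
          simp [U]
        have := congrArg φ hsum
        simpa only [map_add, map_mul, map_sum, map_smul, map_prod, hφ, hva, map_zero, zero_mul,
          zero_add, Function.comp_apply] using this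
    have hzero : ∑ t ∈ s.powerset, c (insert a t) • ∏ i ∈ s \ t, SymmetricAlgebra.ι K W (v i)
        = 0 :=
      Finset.sum_eq_zero fun t ht => by rw [hcontract t (Finset.mem_powerset.1 ht), zero_smul]
    rw [hzero, add_zero] at hsum
    -- The remaining terms share the nonzero factor v a, which cancels because the symmetric algebra
    -- is a domain.
    have hdelete : ∀ t ⊆ s, c t = 0 := by
      refine ih v c ?_ ?_
      · rintro t ht ⟨e, he, hspan⟩
        exact hc t (ht.trans (Finset.subset_insert _ _)) ⟨e, Finset.mem_insert_of_mem he, hspan⟩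
      · refine (mul_eq_zero.1 hsum).resolve_left fun h => ha ?_
        exact SymmetricAlgebra.ι_injective K W (h.trans (map_zero _).symm)
    intro B hB
    by_cases haB : a ∈ B
    · rw [← Finset.insert_erase haB]
      exact hcontract _ (by rwa [← Finset.subset_insert_iff])
    · exact hdelete B ((Finset.subset_insert_iff_of_notMem haB).1 hB)

variable {K V : Type*} [Field K] [AddCommGroup V] [Module K V] {n : ℕ} (Δ : Fin n → Dual K V)

theorem linearIndepOn_formProduct_compl_nbc :
    LinearIndepOn K (fun B : Finset (Fin n) => formProduct Δ Bᶜ)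
      {B | (vectorMatroid K Δ).IsNBC (B : Set (Fin n))} := by
  classical
  rw [linearIndepOn_iff]
  intro l hl hl0
  rw [Finsupp.mem_supported] at hl
  have hzero := eq_zero_of_sum_smul_prod_sdiff_eq_zero (K := K) Δ Finset.univ l ?_ ?_
  · ext B
    exact hzero B (Finset.subset_univ _)
  · rintro B - ⟨e, -, he⟩
    by_contra hB
    exact isNBC_vectorMatroid_iff.1 (hl (Finsupp.mem_support_iff.2 hB)) e he
  · rw [Finsupp.linearCombination_apply, Finsupp.sum_fintype _ _ (by simp)] at hl0
    simpa [formProduct, Finset.compl_eq_univ_sdiff] using hl0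

/-- If B is not nbc, some α_e with e ∉ B is a combination of the α_i with i ∈ B, i > e. Substituting
for the factor α_e turns B into the sets B - i + e; those with nonzero coefficient are bases of the
same flat with smaller index sum, so the rewriting stops. -/
theorem formProduct_compl_mem_span_nbc (B : Finset (Fin n))
    (hB : (vectorMatroid K Δ).Indep (B : Set (Fin n))) :
    formProduct Δ Bᶜ ∈ Submodule.span K ((fun B : Finset (Fin n) => formProduct Δ Bᶜ) ''
      {A | (vectorMatroid K Δ).IsNBC (A : Set (Fin n)) ∧
        (vectorMatroid K Δ).closure (A : Set (Fin n)) =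
          (vectorMatroid K Δ).closure (B : Set (Fin n))}) := by
  induction hm : ∑ i ∈ B, (i : ℕ) using Nat.strong_induction_on generalizing B with
  | _ m ih =>
    by_cases hnbc : (vectorMatroid K Δ).IsNBC (B : Set (Fin n))
    · exact Submodule.subset_span ⟨B, ⟨hnbc, rfl⟩, rfl⟩
    simp only [isNBC_vectorMatroid_iff, not_forall, not_not] at hnbc
    obtain ⟨e, he⟩ := hnbc
    have hecl : e ∈ (vectorMatroid K Δ).closure (B : Set (Fin n)) :=
      mem_closure_vectorMatroid.2
        (Submodule.span_mono (Set.image_mono (Set.sep_subset _ _)) he)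
    have heB : e ∉ B := fun h => hB.notMem_closure_sdiff_of_mem h <|
      mem_closure_vectorMatroid.2 <| Submodule.span_mono
        (Set.image_mono fun i hi => (⟨hi.1, hi.2.ne'⟩ : i ∈ (B : Set (Fin n)) \ {e})) he
    have hfilter : {i ∈ (B : Set (Fin n)) | e < i} =
        ((B.filter (e < ·) : Finset (Fin n)) : Set (Fin n)) := by ext; simp
    rw [hfilter, Submodule.mem_span_image_finset_iff_exists_fun'] at he
    obtain ⟨c, hc⟩ := he
    have hexp : formProduct Δ Bᶜ =
        ∑ i ∈ B.filter (e < ·), c i • formProduct Δ (insert e (B.erase i))ᶜ := by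
      have hBc : Bᶜ = insert e (insert e B)ᶜ := by
        ext i; by_cases h : i = e <;> simp [h, heB]
      rw [hBc, formProduct, Finset.prod_insert (by simp), ← hc, map_sum, Finset.sum_mul]
      refine Finset.sum_congr rfl fun i hi => ?_
      rw [Finset.mem_filter] at hi
      have hBi : (insert e (B.erase i))ᶜ = insert i (insert e B)ᶜ := by
        ext j; by_cases h : j = i
        · subst h; simp [hi.2.ne']
        · simp [h]
      rw [hBi, formProduct, Finset.prod_insert (by simp [hi.1]), map_smul, smul_mul_assoc]
    rw [hexp]
    refine Submodule.sum_mem _ fun i hi => ?_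
    by_cases hci : c i = 0
    · rw [hci, zero_smul]; exact zero_mem _
    refine Submodule.smul_mem _ _ ?_
    have hiF := Finset.mem_filter.1 hi
    have hset : ((insert e (B.erase i) : Finset (Fin n)) : Set (Fin n)) =
        insert e (B : Set (Fin n)) \ {i} := by
      rw [Finset.coe_insert, Finset.coe_erase, Set.insert_sdiff_singleton_comm hiF.2.ne]
    -- As c i ≠ 0, the relation can be solved for Δ i.
    have hicl : i ∈ (vectorMatroid K Δ).closure (insert e (B : Set (Fin n)) \ {i}) := by
      rw [mem_closure_vectorMatroid]
      have hsplit : c i • Δ i = Δ e - ∑ j ∈ (B.filter (e < ·)).erase i, c j • Δ j := by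
        rw [eq_sub_iff_add_eq, Finset.add_sum_erase _ (fun j => c j • Δ j) hi, hc]
      rw [← inv_smul_smul₀ hci (Δ i), hsplit]
      refine Submodule.smul_mem _ _ (Submodule.sub_mem _ ?_ (Submodule.sum_mem _ fun j hj => ?_))
      · exact Submodule.subset_span ⟨e, ⟨by simp, hiF.2.ne⟩, rfl⟩
      · rw [Finset.mem_erase, Finset.mem_filter] at hj
        exact Submodule.smul_mem _ _ (Submodule.subset_span ⟨j, ⟨Or.inr hj.2.1, hj.1⟩, rfl⟩)
    have hlt : ∑ j ∈ insert e (B.erase i), (j : ℕ) < m := by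
      rw [Finset.sum_insert (by simp [heB]), ← hm, ← Finset.add_sum_erase B _ hiF.1]
      exact Nat.add_lt_add_right hiF.2 _
    have hind := hB.indep_insert_sdiff_of_mem_closure hecl hicl (Or.inr hiF.1)
    have hcl := hB.closure_insert_sdiff_eq_of_mem_closure hecl hicl
    rw [← hset] at hind hcl
    simpa only [hcl] using ih _ hlt _ hind rfl

end NBCProducts

/-! ### The flat spaces, their sum and its Hilbert series -/

section FlatSpaces

variable {K V : Type*} [Field K] [AddCommGroup V] [Module K V] {n : ℕ} (Δ : Fin n → Dual K V)

theorem formProduct_compl_mem_homogeneousPart (B : Finset (Fin n)) :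
    formProduct Δ Bᶜ ∈ SymmetricAlgebra.homogeneousPart K (Dual K V) Bᶜ.card :=
  SymmetricAlgebra.prod_ι_mem_homogeneousPart Δ Bᶜ

theorem flatSpaceTop_eq_span_nbc {X : Set (Fin n)} (hX : (vectorMatroid K Δ).IsFlat X) :
    flatSpaceTop Δ X = Submodule.span K ((fun B : Finset (Fin n) => formProduct Δ Bᶜ) ''
      {B | (vectorMatroid K Δ).IsNBC (B : Set (Fin n)) ∧
        (vectorMatroid K Δ).closure (B : Set (Fin n)) = X}) := by
  have hspace : flatSpace Δ X = Submodule.span K ((fun B : Finset (Fin n) => formProduct Δ Bᶜ) ''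
      {B | (vectorMatroid K Δ).closure (B : Set (Fin n)) = X}) := by
    rw [flatSpace]
    congr 1
    ext p
    constructor
    · rintro ⟨S, hS, rfl⟩
      exact ⟨Sᶜ, by simpa using hS, by simp⟩
    · rintro ⟨B, hB, rfl⟩
      exact ⟨Bᶜ, by simpa using hB, rfl⟩
  rw [flatSpaceTop, flatSpaceDeg, hspace, SymmetricAlgebra.span_image_inf_homogeneousPart
    (formProduct_compl_mem_homogeneousPart Δ)]
  have hrank : ∀ B : Finset (Fin n), (vectorMatroid K Δ).closure (B : Set (Fin n)) = X →
      (vectorMatroid K Δ).rankNat X = (vectorMatroid K Δ).rankNat (B : Set (Fin n)) := by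
    rintro B rfl
    rw [Matroid.rankNat_closure]
  apply le_antisymm
  · rw [Submodule.span_le]
    rintro _ ⟨B, ⟨rfl, hcard⟩, rfl⟩
    refine formProduct_compl_mem_span_nbc Δ B ?_
    have hle := (vectorMatroid K Δ).rankNat_le_card B
    have hn := B.card_le_univ
    rw [hrank B rfl, Finset.card_compl, Fintype.card_fin] at hcard
    rw [Fintype.card_fin] at hn
    -- Both r(B) and |B| are at most n, so the truncated differences in `hcard` determine them.
    have heq : (vectorMatroid K Δ).rankNat (B : Set (Fin n)) = B.card := by omega
    rw [Matroid.indep_iff_eRk_eq_encard, Set.encard_coe_eq_coe_finsetCard, ← heq,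
      Matroid.rankNat, ENat.natCast_toNat]
    exact ((Matroid.eRk_le_encard _ _).trans_lt (B.finite_toSet.encard_lt_top)).ne
  · refine Submodule.span_mono (Set.image_mono ?_)
    rintro B ⟨hB, hcl⟩
    refine ⟨hcl, ?_⟩
    rw [hrank B hcl, hB.indep.rankNat_eq_ncard, Set.ncard_coe_finset, Finset.card_compl,
      Fintype.card_fin]

/-- An arbitrary index type serves both the sum over all flats and the sum over all flats but one.
-/
theorem iSup_flatSpaceTop_eq_span_nbc {ι : Type*} (X : ι → Set (Fin n))
    (hX : ∀ i, (vectorMatroid K Δ).IsFlat (X i)) :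
    ⨆ i, flatSpaceTop Δ (X i) =
      Submodule.span K ((fun B : Finset (Fin n) => formProduct Δ Bᶜ) ''
        {B | (vectorMatroid K Δ).IsNBC (B : Set (Fin n)) ∧
          ∃ i, (vectorMatroid K Δ).closure (B : Set (Fin n)) = X i}) := by
  simp_rw [fun i => flatSpaceTop_eq_span_nbc Δ (hX i)]
  rw [← Submodule.span_iUnion, ← Set.image_iUnion]
  congr 2
  ext B
  simp

theorem iSup_isFlat_flatSpaceTop_eq_span_nbc :
    ⨆ X : {X : Set (Fin n) // (vectorMatroid K Δ).IsFlat X}, flatSpaceTop Δ X.1 =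
      Submodule.span K ((fun B : Finset (Fin n) => formProduct Δ Bᶜ) ''
        {B | (vectorMatroid K Δ).IsNBC (B : Set (Fin n))}) := by
  rw [iSup_flatSpaceTop_eq_span_nbc Δ _ fun X => X.2]
  congr 2
  ext B
  exact and_iff_left ⟨⟨_, (vectorMatroid K Δ).isFlat_closure _⟩, rfl⟩

/-- One summand and the sum of the others are spanned by disjoint parts of a single linearly
independent family, as each nbc set has only one closure. -/
theorem iSupIndep_flatSpaceTop :
    iSupIndep (fun X : {X : Set (Fin n) // (vectorMatroid K Δ).IsFlat X} =>
      flatSpaceTop Δ X.1) := by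
  intro X
  have hrest := iSup_flatSpaceTop_eq_span_nbc Δ
    (fun Y : {Y : {X : Set (Fin n) // (vectorMatroid K Δ).IsFlat X} // Y ≠ X} => Y.1.1)
    fun Y => Y.1.2
  rw [iSup_subtype] at hrest
  rw [hrest]
  beta_reduce
  rw [flatSpaceTop_eq_span_nbc Δ X.2]
  refine ((linearIndepOn_union_iff ?_).1
    ((linearIndepOn_formProduct_compl_nbc Δ).mono ?_)).2.2
  · rw [Set.disjoint_left]
    rintro B ⟨-, hB⟩ ⟨-, Y, hY⟩
    exact Y.2 (Subtype.ext (hY.symm.trans hB))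
  · rintro B (hB | hB)
    exacts [hB.1, hB.1]

theorem finrank_flatSpaceTop {X : Set (Fin n)} (hX : (vectorMatroid K Δ).IsFlat X) :
    finrank K (flatSpaceTop Δ X) = {S : Set (Fin n) | (vectorMatroid K Δ).IsNBC S ∧
      (vectorMatroid K Δ).closure S = X}.ncard := by
  rw [flatSpaceTop_eq_span_nbc Δ hX, finrank_span_image_of_linearIndepOn (Set.toFinite _)
    ((linearIndepOn_formProduct_compl_nbc Δ).mono fun B hB => hB.1),
    ← Set.ncard_image_of_injective _ (Finset.coe_injective (α := Fin n))]
  congr 1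
  ext S
  constructor
  · rintro ⟨B, hB, rfl⟩
    exact hB
  · intro hS
    classical
    exact ⟨S.toFinset, by simpa using hS, by simp⟩

open scoped Classical in
theorem hilbertSeries_span_nbc :
    SymmetricAlgebra.hilbertSeries
      (Submodule.span K ((fun B : Finset (Fin n) => formProduct Δ Bᶜ) ''
        {B | (vectorMatroid K Δ).IsNBC (B : Set (Fin n))})) =
      ∑ B ∈ Finset.univ.filter
        (fun B : Finset (Fin n) => (vectorMatroid K Δ).IsNBC (B : Set (Fin n))),
        (PowerSeries.X : PowerSeries ℤ) ^ (n - B.card) := by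
  ext d
  rw [SymmetricAlgebra.hilbertSeries, PowerSeries.coeff_mk,
    SymmetricAlgebra.span_image_inf_homogeneousPart
      (formProduct_compl_mem_homogeneousPart Δ),
    finrank_span_image_of_linearIndepOn (Set.toFinite _)
      ((linearIndepOn_formProduct_compl_nbc Δ).mono fun B hB => hB.1), map_sum]
  simp_rw [PowerSeries.coeff_X_pow]
  rw [Finset.sum_boole, Finset.filter_filter, ← Set.ncard_coe_finset]
  congr 2
  ext B
  simp [Finset.card_compl, eq_comm]

theorem X_pow_mul_aeval_tuttePolynomial [FiniteDimensional K V]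
    (hΔ : Submodule.span K (Set.range Δ) = ⊤) :
    (PowerSeries.X : PowerSeries ℤ) ^ (n - finrank K V) *
        MvPolynomial.aeval ![1 + (PowerSeries.X : PowerSeries ℤ), 0]
          (vectorMatroid K Δ).tuttePolynomial =
      ∑ A : Finset (Fin n), (-1) ^ (A.card - (vectorMatroid K Δ).rankNat A) *
        (PowerSeries.X : PowerSeries ℤ) ^ (n - (vectorMatroid K Δ).rankNat A) := by
  classical
  have hE : (vectorMatroid K Δ).rankNat Set.univ = finrank K V := by
    rw [rankNat_vectorMatroid, Set.image_univ, hΔ, finrank_top, Subspace.dual_finrank_eq]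
  have hn : finrank K V ≤ n := by
    have := (vectorMatroid K Δ).rankNat_le_card Finset.univ
    rwa [Finset.coe_univ, hE, Finset.card_univ, Fintype.card_fin] at this
  rw [Matroid.tuttePolynomial, map_sum, Finset.mul_sum, vectorMatroid_ground,
    Finset.filter_true_of_mem fun _ _ => Set.subset_univ _]
  refine Finset.sum_congr rfl fun A _ => ?_
  have hA := (vectorMatroid K Δ).rankNat_mono (Set.subset_univ (A : Set (Fin n)))
  rw [hE] at hA ⊢
  -- Splits n - r(A) as (n - ℓ) + (ℓ - r(A)): the prefactor and the power of x - 1 = t.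
  rw [← Nat.sub_add_sub_cancel hn hA, pow_add]
  simp only [map_mul, map_pow, map_sub, MvPolynomial.aeval_X, map_one, Matrix.cons_val_zero,
    Matrix.cons_val_one, add_sub_cancel_left, zero_sub]
  ring

end FlatSpaces

theorem mainTheorem6 {K V : Type*} [Field K] [AddCommGroup V] [Module K V]
    [FiniteDimensional K V] {n : ℕ} (Δ : Fin n → Module.Dual K V)
    (hΔ : Submodule.span K (Set.range Δ) = ⊤) :
    -- the sum of the subspaces `P(Δ)_{X,r(X)}`, over all flats `X`, is direct and graded
    iSupIndep (fun X : {X : Set (Fin n) // (vectorMatroid K Δ).IsFlat X} =>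
      flatSpaceTop Δ X.1) ∧
    SymmetricAlgebra.IsGradedSubspace
      (⨆ X : {X : Set (Fin n) // (vectorMatroid K Δ).IsFlat X}, flatSpaceTop Δ X.1) ∧
    -- its Hilbert series is `t ^ (n - ℓ) * T(Δ; 1 + t, 0)`
    SymmetricAlgebra.hilbertSeries
      (⨆ X : {X : Set (Fin n) // (vectorMatroid K Δ).IsFlat X}, flatSpaceTop Δ X.1) =
        PowerSeries.X ^ (n - Module.finrank K V) *
          MvPolynomial.aeval ![1 + (PowerSeries.X : PowerSeries ℤ), 0]
            (vectorMatroid K Δ).tuttePolynomial ∧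
    -- `dim P(Δ)_{X,r(X)}` is the number of nbc sets with closure `X`
    ∀ X : Set (Fin n), (vectorMatroid K Δ).IsFlat X →
      Module.finrank K (flatSpaceTop Δ X) =
        {S : Set (Fin n) | (vectorMatroid K Δ).IsNBC S ∧
          (vectorMatroid K Δ).closure S = X}.ncard := by
  refine ⟨iSupIndep_flatSpaceTop Δ, ?_, ?_, fun X hX => finrank_flatSpaceTop Δ hX⟩
  · rw [iSup_isFlat_flatSpaceTop_eq_span_nbc]
    exact SymmetricAlgebra.isGradedSubspace_span_image
      (formProduct_compl_mem_homogeneousPart Δ) _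
  · classical
    rw [iSup_isFlat_flatSpaceTop_eq_span_nbc, hilbertSeries_span_nbc,
      X_pow_mul_aeval_tuttePolynomial Δ hΔ, Matroid.sum_neg_one_pow_nullity_mul_rankNat
        vectorMatroid_ground fun k => (PowerSeries.X : PowerSeries ℤ) ^ (n - k)]
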